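/- Let $d\ge 1$ be an integer, let $0\le\alpha<d$, and let $1<p<\infty$ and $0<q<\infty$ satisfy $\frac1q=\frac1p-\frac{\alpha}{d}$; put $p'=\frac{p}{p-1}$. Cubes are nondegenerate cubes in $\mathbb{R}^d$ with sides parallel to the axes, and $|Q|$ is the Lebesgue measure of $Q$. For a locally integrable $\varphi:\mathbb{R}^d\to\mathbb{R}$ let $$\mathcal{M}^\alpha\varphi(x)=\sup\Big\{|Q|^{\frac{\alpha}{d}-1}\int_Q|\varphi(u)|\,du:\ Q\text{ a cube containing }x\Big\}.$$ A weight is a locally integrable function $w$ on $\mathbb{R}^d$ that is positive almost everywhere; for $1<r<\infty$ put $$[w]_{A_r}=\sup_Q\Big(\frac1{|Q|}\int_Q w\Big)\Big(\frac1{|Q|}\int_Q w^{-1/(r-1)}\Big)^{r-1}\in[0,\infty],$$ the supremum being over all cubes, and call $w$ an $A_r$ weight if $[w]_{A_r}<\infty$. Write $\|f\|_{L^p(w)}=\big(\int_{\mathbb{R}^d}|f|^p w\,du\big)^{1/p}\in[0,\infty]$. Then for every $A_{q/p'+1}$ weight $w$ and every locally integrable $\varphi:\mathbb{R}^d\to\mathbb{R}$,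 $$\|\mathcal{M}^\alpha\varphi\|_{L^q(w)}\le C^d\,\inf_{1<r<q/p'+1}\Big\{[w]_{A_r}^{1/(q-s)}\Big(\frac qs\Big)^{1/(q-s)}\Big\}\,\|\varphi\|_{L^p(w^{p/q})},\qquad s=s(r)=q-\frac{rq^2}{(r-1)(q-p)+pq},$$ with the absolute constant $C=12$. -/

import Mathlib

open MeasureTheory
open scoped ENNReal

noncomputable section

/-- `Q ⊆ ℝ^d` is a (nondegenerate) cube with sides parallel to the axes. -/
def IsCube {d : ℕ} (Q : Set (Fin d → ℝ)) : Prop :=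
  ∃ (a : Fin d → ℝ) (l : ℝ), 0 < l ∧ Q = Set.Icc a (fun i => a i + l)

/-- The fractional maximal operator
`M^α φ(x) = sup { |Q|^(α/d - 1) ∫_Q |φ| : Q a cube containing x }`, with values in `[0, ∞]`. -/
def fracMaximal {d : ℕ} (α : ℝ) (φ : (Fin d → ℝ) → ℝ) (x : Fin d → ℝ) : ℝ≥0∞ :=
  ⨆ (Q : Set (Fin d → ℝ)) (_ : IsCube Q) (_ : x ∈ Q),
    volume Q ^ (α / (d : ℝ) - 1) * ∫⁻ u in Q, ENNReal.ofReal |φ u|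

/-- A weight: a locally integrable function on `ℝ^d` that is positive (almost everywhere). -/
structure IsWeight {d : ℕ} (w : (Fin d → ℝ) → ℝ) : Prop where
  locallyIntegrable : LocallyIntegrable w volume
  pos : ∀ᵐ x ∂volume, 0 < w x

/-- The `A_r` characteristic
`[w]_{A_r} = sup_Q (|Q|⁻¹ ∫_Q w) (|Q|⁻¹ ∫_Q w^(-1/(r-1)))^(r-1)`, with values in `[0, ∞]`. -/
def apChar {d : ℕ} (r : ℝ) (w : (Fin d → ℝ) → ℝ) : ℝ≥0∞ :=
  ⨆ (Q : Set (Fin d → ℝ)) (_ : IsCube Q),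
    ((volume Q)⁻¹ * ∫⁻ x in Q, ENNReal.ofReal (w x)) *
      ((volume Q)⁻¹ * ∫⁻ x in Q, ENNReal.ofReal (w x ^ (-1 / (r - 1)))) ^ (r - 1)

/-- `w` is an `A_r` weight (used for `1 < r < ∞`). -/
def IsApWeight {d : ℕ} (r : ℝ) (w : (Fin d → ℝ) → ℝ) : Prop :=
  IsWeight w ∧ apChar r w < ∞

/-- The norm of `L^p(w)`, that is `(∫ |f|^p w)^(1/p)`, with values in `[0, ∞]`;
the function `f` is real-valued or `[0, ∞]`-valued. -/
def weightedNorm {d : ℕ} {E : Type} [ENorm E] (p : ℝ) (w : (Fin d → ℝ) → ℝ)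
    (f : (Fin d → ℝ) → E) : ℝ≥0∞ :=
  (∫⁻ x, ‖f x‖ₑ ^ p * ENNReal.ofReal (w x)) ^ (1 / p)

/-- The exponent `s = q - r q² / ((r - 1)(q - p) + p q)`. -/
def sExponent (p q r : ℝ) : ℝ :=
  q - r * q ^ 2 / ((r - 1) * (q - p) + p * q)

end

/-! Put `a = α / d` and `t = r / (1 + (r - 1) a)`. On a cube `Q`, split `∫_Q |φ|` into its powers
`p/q` and `1 - p/q`. Hölder with exponent `t` bounds the first by the `w`-average of `g = |φ|^t
w^(-ta)`; Hölder with exponent `p`, followed by Jensen, bounds the second by `N =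
‖φ‖_{L^p(w^(p/q))}`. After the `A_r` condition is inserted, all powers of `|Q|` cancel
(`rpow_mul_lintegral_le`): `|Q|^(a-1) ∫_Q |φ| ≤ [w]^e (w(Q)⁻¹ ∫_Q g w)^e N^(1-p/q)`, where `e =
p/(qt) = 1/(q-s)`.

So the fractional maximal function is controlled by the `e`-th power of a maximal function of `g`
for the measure `w dx`. For a dyadic grid the latter is bounded on `L^(p/t)(w)` with norm `(p/t)' =
q/s`, by Doob's argument, with no doubling needed. The exponents fit because `e q = p/t` and
`g^(p/t) w = |φ|^p w^(p/q)`.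

The one-third trick puts every cube in a cube of one of `2^d` grids, at most `6^d` times larger.
Summing over grids costs `2^(d/q) ≤ 2^d`, whence `12 = 2 · 6`. -/

/-- The maximal function of `g` over the sets `D i`, with averages taken with respect to `μ`. -/
noncomputable def familyMaximal {X ι : Type*} [MeasurableSpace X] (μ : Measure X) (D : ι → Set X)
    (g : X → ℝ≥0∞) (x : X) : ℝ≥0∞ :=
  ⨆ i, (D i).indicator (fun _ => (μ (D i))⁻¹ * ∫⁻ y in D i, g y ∂μ) x

/-- A family of sets is laminar if any two members are nested or disjoint. -/
def IsLaminar {X ι : Type*} (D : ι → Set X) : Prop :=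
  ∀ i j, D i ⊆ D j ∨ D j ⊆ D i ∨ Disjoint (D i) (D j)

/-! ### Doob's maximal inequality for laminar families. -/

section Laminar

variable {X ι : Type*} [MeasurableSpace X] {μ : Measure X} {D : ι → Set X} {g : X → ℝ≥0∞}

/-- The maximal members of a finite laminar family are disjoint with the same union, so the
hypotheses add up without loss. The induction either discards a set lying in another one, or splits
off a set that every other member is contained in or disjoint from. -/
theorem IsLaminar.mul_measure_biUnion_le (hD : IsLaminar D) (hm : ∀ i, MeasurableSet (D i))
    {c : ℝ≥0∞} (F : Finset ι) (hc : ∀ i ∈ F, c * μ (D i) ≤ ∫⁻ x in D i, g x ∂μ) :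
    c * μ (⋃ i ∈ F, D i) ≤ ∫⁻ x in ⋃ i ∈ F, D i, g x ∂μ := by
  classical
  induction F using Finset.strongInduction with
  | H F ih =>
  rcases F.eq_empty_or_nonempty with rfl | ⟨i, hi⟩
  · simp
  by_cases h : ∃ j ∈ F.erase i, D i ⊆ D j
  · obtain ⟨j, hj, hij⟩ := h
    have hU : (⋃ k ∈ F, D k) = ⋃ k ∈ F.erase i, D k := by
      conv_lhs => rw [← Finset.insert_erase hi]
      rw [Finset.set_biUnion_insert]
      exact Set.union_eq_right.2 (hij.trans (Set.subset_biUnion_of_mem (u := D) (by exact hj)))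
    rw [hU]
    exact ih _ (Finset.erase_ssubset hi) fun k hk => hc k (Finset.mem_of_mem_erase hk)
  · push Not at h
    set E := (F.erase i).filter fun j => Disjoint (D i) (D j) with hE
    have hEF : E ⊂ F := lt_of_le_of_lt (Finset.filter_subset _ _) (Finset.erase_ssubset hi)
    have hU : (⋃ k ∈ F, D k) = D i ∪ ⋃ k ∈ E, D k := by
      apply Set.Subset.antisymm
      · refine Set.iUnion₂_subset fun k hk => ?_
        by_cases hki : k = i
        · subst hki; exact Set.subset_union_left
        have hk' : k ∈ F.erase i := Finset.mem_erase.2 ⟨hki, hk⟩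
        rcases hD i k with h1 | h1 | h1
        · exact absurd h1 (h k hk')
        · exact h1.trans Set.subset_union_left
        · exact (Set.subset_biUnion_of_mem (u := D)
            (show k ∈ E from Finset.mem_filter.2 ⟨hk', h1⟩)).trans Set.subset_union_right
      · refine Set.union_subset (Set.subset_biUnion_of_mem (u := D) (by exact hi)) ?_
        exact Set.biUnion_subset_biUnion_left fun k hk => hEF.1 hk
    have hdisj : Disjoint (D i) (⋃ k ∈ E, D k) :=
      Set.disjoint_iUnion₂_right.2 fun k hk => (Finset.mem_filter.1 hk).2
    have hmE : MeasurableSet (⋃ k ∈ E, D k) := Finset.measurableSet_biUnion _ fun k _ => hm k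
    rw [hU, measure_union hdisj hmE, lintegral_union hmE hdisj, mul_add]
    exact add_le_add (hc i hi) (ih E hEF fun k hk => hc k (hEF.1 hk))

theorem setOf_lt_familyMaximal (c : ℝ≥0∞) :
    {x | c < familyMaximal μ D g x} =
      ⋃ i ∈ {i | c < (μ (D i))⁻¹ * ∫⁻ y in D i, g y ∂μ}, D i := by
  ext x
  simp only [familyMaximal, Set.mem_ofPred_eq, lt_iSup_iff, Set.mem_iUnion, exists_prop]
  refine exists_congr fun i => ?_
  by_cases hx : x ∈ D i <;> simp [hx]

theorem measurable_familyMaximal [Countable ι] (hm : ∀ i, MeasurableSet (D i)) :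
    Measurable (familyMaximal μ D g) :=
  Measurable.iSup fun i => measurable_const.indicator (hm i)

/-- Weak type with constant 1. Keeping the integral on the level set, rather than on all of `X`, is
what gives the sharp constant `τ / (τ - 1)`. -/
theorem IsLaminar.mul_measure_lt_familyMaximal_le [Finite ι] (hD : IsLaminar D)
    (hm : ∀ i, MeasurableSet (D i)) (hfin : ∀ i, μ (D i) ≠ ∞) (c : ℝ≥0∞) :
    c * μ {x | c < familyMaximal μ D g x} ≤ ∫⁻ x in {x | c < familyMaximal μ D g x}, g x ∂μ := by
  classical
  have := Fintype.ofFinite ι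
  have h := hD.mul_measure_biUnion_le (μ := μ) (g := g) (c := c) hm
    (Finset.univ.filter fun i => c < (μ (D i))⁻¹ * ∫⁻ y in D i, g y ∂μ) (fun i hi => by
      have hi := (Finset.mem_filter.1 hi).2
      rcases eq_or_ne (μ (D i)) 0 with h0 | h0
      · simp [h0]
      calc c * μ (D i) ≤ ((μ (D i))⁻¹ * ∫⁻ y in D i, g y ∂μ) * μ (D i) := by gcongr
        _ = ∫⁻ y in D i, g y ∂μ := by
          rw [mul_comm, ← mul_assoc, ENNReal.mul_inv_cancel h0 (hfin i), one_mul])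
  simpa [setOf_lt_familyMaximal] using h

theorem lintegral_rpow_eq_lintegral_lt {M : X → ℝ≥0∞} (hM : Measurable M) (hMfin : ∀ x, M x ≠ ∞)
    {s : ℝ} (hs : 0 < s) :
    ∫⁻ x, M x ^ s ∂μ = ENNReal.ofReal s *
      ∫⁻ t in Set.Ioi (0 : ℝ), μ {x | ENNReal.ofReal t < M x} * ENNReal.ofReal (t ^ (s - 1)) := by
  have h := lintegral_rpow_eq_lintegral_meas_lt_mul μ (f := fun x => (M x).toReal)
    (Filter.Eventually.of_forall fun x => ENNReal.toReal_nonneg) hM.ennreal_toReal.aemeasurable hs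
  have h1 : ∀ x, ENNReal.ofReal ((M x).toReal ^ s) = M x ^ s := fun x => by
    rw [← ENNReal.ofReal_rpow_of_nonneg ENNReal.toReal_nonneg hs.le, ENNReal.ofReal_toReal (hMfin x)]
  simp only [h1] at h
  rw [h]
  congr 1
  refine setLIntegral_congr_fun measurableSet_Ioi fun t ht => ?_
  have : {a | t < (M a).toReal} = {x | ENNReal.ofReal t < M x} := by
    ext x
    simp only [Set.mem_ofPred_eq]
    rw [ENNReal.ofReal_lt_iff_lt_toReal (le_of_lt ht) (hMfin x)]
  simp only [this]

/-- Layer-cake and the weak-type bound give `∫ M^τ ≤ τ' ∫ g M^(τ-1)`; Hölder then returns a power of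
`∫ M^τ`, which can be divided out only because `hY` makes it finite. -/
theorem lintegral_rpow_le_of_mul_measure_lt_le {M : X → ℝ≥0∞} (hM : Measurable M)
    (hMfin : ∀ x, M x ≠ ∞) (hg : AEMeasurable g μ) {τ : ℝ} (hτ : 1 < τ)
    (hweak : ∀ c, c * μ {x | c < M x} ≤ ∫⁻ x in {x | c < M x}, g x ∂μ)
    (hY : ∫⁻ x, M x ^ τ ∂μ ≠ ∞) :
    ∫⁻ x, M x ^ τ ∂μ ≤ ENNReal.ofReal (τ / (τ - 1)) ^ τ * ∫⁻ x, g x ^ τ ∂μ := by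
  have h1 : ∫⁻ x, M x ^ τ ∂μ ≤ ENNReal.ofReal (τ / (τ - 1)) * ∫⁻ x, g x * M x ^ (τ - 1) ∂μ := by
    have hν : ∫⁻ x, g x * M x ^ (τ - 1) ∂μ = ∫⁻ x, M x ^ (τ - 1) ∂(μ.withDensity g) := by
      rw [lintegral_withDensity_eq_lintegral_mul₀ hg (hM.pow_const _).aemeasurable]
      rfl
    rw [hν, lintegral_rpow_eq_lintegral_lt hM hMfin (by linarith : 0 < τ),
      lintegral_rpow_eq_lintegral_lt hM hMfin (by linarith : 0 < τ - 1), ← mul_assoc,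
      ← ENNReal.ofReal_mul (div_nonneg (by linarith) (by linarith)),
      div_mul_cancel₀ _ (by linarith : τ - 1 ≠ 0)]
    gcongr ENNReal.ofReal τ * ?_
    refine setLIntegral_mono' measurableSet_Ioi fun t (ht : 0 < t) => ?_
    rw [withDensity_apply _ (measurableSet_lt measurable_const hM)]
    -- The spare factor `t` is the level `c` in the weak-type inequality.
    have ht' : t ^ (τ - 1) = t * t ^ (τ - 1 - 1) := by
      rw [Real.rpow_sub_one ht.ne' (τ - 1), mul_div_cancel₀ _ ht.ne']
    rw [ht', ENNReal.ofReal_mul ht.le, ← mul_assoc, mul_comm (μ _)]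
    gcongr
    exact hweak _
  rcases eq_or_ne (∫⁻ x, M x ^ τ ∂μ) 0 with h0 | h0
  · rw [h0]; exact zero_le
  set Y := ∫⁻ x, M x ^ τ ∂μ with hYdef
  set G := ∫⁻ x, g x ^ τ ∂μ with hG
  set K := ENNReal.ofReal (τ / (τ - 1)) with hK
  have hpq : τ.HolderConjugate (τ / (τ - 1)) := Real.HolderConjugate.conjExponent hτ
  have h2 : ∫⁻ x, g x * M x ^ (τ - 1) ∂μ ≤ G ^ (1 / τ) * Y ^ (1 - 1 / τ) := by
    have h := ENNReal.lintegral_mul_le_Lp_mul_Lq μ hpq hg (hM.pow_const (τ - 1)).aemeasurable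
    have e1 : ∀ x, (M x ^ (τ - 1)) ^ (τ / (τ - 1)) = M x ^ τ := fun x => by
      rw [← ENNReal.rpow_mul, mul_div_cancel₀ _ (by linarith : τ - 1 ≠ 0)]
    simp only [e1] at h
    have e2 : 1 / (τ / (τ - 1)) = 1 - 1 / τ := by
      have : τ ≠ 0 := by linarith
      field_simp
    rw [e2] at h
    exact h
  have h3 : Y ≤ K * G ^ (1 / τ) * Y ^ (1 - 1 / τ) := by
    rw [mul_assoc]; exact h1.trans (by gcongr)
  have h4 : Y ^ (1 / τ) ≤ K * G ^ (1 / τ) := by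
    have hne : Y ^ (1 - 1 / τ) ≠ 0 := by simp [h0, hY]
    have hnt : Y ^ (1 - 1 / τ) ≠ ∞ := by
      have : 1 / τ ≤ 1 := by rw [div_le_one (by linarith)]; linarith
      exact ENNReal.rpow_ne_top_of_nonneg (by linarith) hY
    rw [← ENNReal.mul_le_mul_iff_left hne hnt, ← ENNReal.rpow_add _ _ h0 hY]
    simpa using h3
  have h5 := ENNReal.rpow_le_rpow h4 (by linarith : 0 ≤ τ)
  rwa [ENNReal.mul_rpow_of_nonneg _ _ (by linarith), ← ENNReal.rpow_mul, ← ENNReal.rpow_mul,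
    one_div_mul_cancel (by linarith), ENNReal.rpow_one, ENNReal.rpow_one] at h5

theorem IsLaminar.lintegral_familyMaximal_rpow_le_of_finite [Finite ι] (hD : IsLaminar D)
    (hm : ∀ i, MeasurableSet (D i)) (hfin : ∀ i, μ (D i) ≠ ∞) (hg : AEMeasurable g μ)
    {τ : ℝ} (hτ : 1 < τ) :
    ∫⁻ x, familyMaximal μ D g x ^ τ ∂μ ≤
      ENNReal.ofReal (τ / (τ - 1)) ^ τ * ∫⁻ x, g x ^ τ ∂μ := by
  have hτ0 : 0 < τ := by linarith
  have := Fintype.ofFinite ι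
  rcases eq_or_ne (∫⁻ x, g x ^ τ ∂μ) ∞ with hG | hG
  · have : ENNReal.ofReal (τ / (τ - 1)) ^ τ ≠ 0 := by
      have : 0 < τ / (τ - 1) := div_pos hτ0 (by linarith)
      simp [ENNReal.rpow_eq_zero_iff, this, not_lt.2 hτ0.le]
    rw [hG, ENNReal.mul_top this]
    exact le_top
  have hint : ∀ i, ∫⁻ x in D i, g x ∂μ ≠ ∞ := fun i => by
    have h := ENNReal.lintegral_mul_le_Lp_mul_Lq (μ.restrict (D i))
      (Real.HolderConjugate.conjExponent hτ) hg.restrict (aemeasurable_const (b := (1 : ℝ≥0∞)))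
    simp only [Pi.mul_apply, mul_one, ENNReal.one_rpow, lintegral_const,
      one_mul, Measure.restrict_apply_univ] at h
    refine ne_top_of_le_ne_top (ENNReal.mul_ne_top ?_ ?_) h
    · exact ENNReal.rpow_ne_top_of_nonneg (by positivity)
        (ne_top_of_le_ne_top hG (setLIntegral_le_lintegral _ _))
    · exact ENNReal.rpow_ne_top_of_nonneg
        (one_div_nonneg.2 (div_nonneg hτ0.le (by linarith))) (hfin i)
  have havg : ∀ i, (μ (D i))⁻¹ * ∫⁻ x in D i, g x ∂μ ≠ ∞ := fun i => by
    rcases eq_or_ne (μ (D i)) 0 with h0 | h0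
    · have : ∫⁻ x in D i, g x ∂μ = 0 := setLIntegral_measure_zero _ _ h0
      simp [this]
    · exact ENNReal.mul_ne_top (ENNReal.inv_ne_top.2 h0) (hint i)
  -- The maximal function is at most `B` and vanishes off a set of finite measure, so its `τ`-th
  -- power is integrable as Doob's argument requires.
  set B := ∑ i, (μ (D i))⁻¹ * ∫⁻ x in D i, g x ∂μ with hB
  have hBt : B ≠ ∞ := ENNReal.sum_ne_top.2 fun i _ => havg i
  have hle : ∀ x, familyMaximal μ D g x ≤ (⋃ i, D i).indicator (fun _ => B) x := fun x => by
    refine iSup_le fun i => ?_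
    by_cases hx : x ∈ D i
    · rw [Set.indicator_of_mem hx, Set.indicator_of_mem (Set.mem_iUnion.2 ⟨i, hx⟩)]
      exact Finset.single_le_sum (f := fun i => (μ (D i))⁻¹ * ∫⁻ x in D i, g x ∂μ)
        (fun _ _ => zero_le) (Finset.mem_univ i)
    · rw [Set.indicator_of_notMem hx]; exact zero_le
  have hU : μ (⋃ i, D i) ≠ ∞ :=
    ne_top_of_le_ne_top (ENNReal.sum_ne_top.2 fun i _ => hfin i) (measure_iUnion_fintype_le μ D)
  refine lintegral_rpow_le_of_mul_measure_lt_le (measurable_familyMaximal hm) (fun x => ?_) hg hτ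
    (hD.mul_measure_lt_familyMaximal_le hm hfin) ?_
  · refine ne_top_of_le_ne_top ?_ (hle x)
    by_cases hx : x ∈ ⋃ i, D i <;> simp [hx, hBt, Set.indicator]
  · refine ne_top_of_le_ne_top (b := B ^ τ * μ (⋃ i, D i))
      (ENNReal.mul_ne_top (ENNReal.rpow_ne_top_of_nonneg hτ0.le hBt) hU) ?_
    rw [← lintegral_indicator_const (MeasurableSet.iUnion hm)]
    refine lintegral_mono fun x => ?_
    refine (ENNReal.rpow_le_rpow (hle x) hτ0.le).trans ?_
    by_cases hx : x ∈ ⋃ i, D i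
    · simp only [Set.indicator_of_mem hx]; exact le_rfl
    · simp only [Set.indicator_of_notMem hx]; simp [hτ0]

/-- The maximal operator of a countable laminar family is bounded on `L^τ(μ)`
with norm at most `τ / (τ - 1)`. -/
theorem IsLaminar.lintegral_familyMaximal_rpow_le [Countable ι] (hD : IsLaminar D)
    (hm : ∀ i, MeasurableSet (D i)) (hfin : ∀ i, μ (D i) ≠ ∞) (hg : AEMeasurable g μ)
    {τ : ℝ} (hτ : 1 < τ) :
    ∫⁻ x, familyMaximal μ D g x ^ τ ∂μ ≤
      ENNReal.ofReal (τ / (τ - 1)) ^ τ * ∫⁻ x, g x ^ τ ∂μ := by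
  have hτ0 : 0 < τ := by linarith
  -- Finite subfamilies stay laminar and exhaust the supremum, so monotone convergence applies.
  have hsup : ∀ x, familyMaximal μ D g x ^ τ =
      ⨆ F : Finset ι, familyMaximal μ (fun i : F => D i) g x ^ τ := fun x => by
    have h1 : familyMaximal μ D g x = ⨆ F : Finset ι, familyMaximal μ (fun i : F => D i) g x := by
      unfold familyMaximal
      rw [iSup_eq_iSup_finset]
      simp only [iSup_subtype]
    rw [h1]
    exact (ENNReal.monotone_rpow_of_nonneg hτ0.le).map_iSup_of_continuousAt
      (ENNReal.continuous_rpow_const.continuousAt) (by simp [hτ0])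
  simp only [hsup]
  rw [lintegral_iSup_directed]
  · refine iSup_le fun F => ?_
    exact IsLaminar.lintegral_familyMaximal_rpow_le_of_finite (D := fun i : F => D i) (fun i j => hD i j) (fun i => hm i)
      (fun i => hfin i) hg hτ
  · exact fun F => ((measurable_familyMaximal fun i : F => hm i).pow_const _).aemeasurable
  · refine Monotone.directed_le fun F F' h x => ENNReal.rpow_le_rpow ?_ hτ0.le
    refine iSup_le fun i => ?_
    exact le_iSup (fun i : F' => (D i).indicator
      (fun _ => (μ (D i))⁻¹ * ∫⁻ y in D i, g y ∂μ) x) ⟨i, h i.2⟩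

end Laminar

/-! ### Dyadic grids and the one-third trick. -/

/-- The shift, relative to the side length `2 ^ k`, of the `k`-th generation of the standard dyadic
grid (`b = false`) and of its one-third translate (`b = true`). -/
noncomputable def gridShift (b : Bool) (k : ℤ) : ℝ :=
  if b then (if Even k then 1 / 3 else -1 / 3) else 0

/-- The index of the `k`-th generation dyadic interval containing `x`. -/
noncomputable def gridIndex (b : Bool) (k : ℤ) (x : ℝ) : ℤ :=
  ⌊x / 2 ^ k - gridShift b k⌋

/-- The dyadic cubes, indexed by generation and position. -/
def gridCube {d : ℕ} (δ : Fin d → Bool) (j : ℤ × (Fin d → ℤ)) : Set (Fin d → ℝ) :=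
  {x | ∀ i, gridIndex (δ i) j.1 (x i) = j.2 i}

/-- This makes the generations nested. The alternating sign of the shift matters: `±1/3 - 2 (∓1/3) =
±1` is an integer. -/
theorem exists_gridIndex_succ (b : Bool) (k : ℤ) :
    ∃ e : ℤ, ∀ x, gridIndex b (k + 1) x = (gridIndex b k x + e) / 2 := by
  obtain ⟨e, he⟩ : ∃ e : ℤ, (e : ℝ) = gridShift b k - 2 * gridShift b (k + 1) := by
    unfold gridShift
    rcases b with _ | _
    · exact ⟨0, by simp⟩
    · by_cases hk : Even k
      · refine ⟨1, ?_⟩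
        simp only [hk, Int.even_add_one]
        norm_num
      · refine ⟨-1, ?_⟩
        simp only [hk, Int.even_add_one]
        norm_num
  refine ⟨e, fun x => ?_⟩
  have h2 : x / 2 ^ (k + 1) - gridShift b (k + 1) =
      ((x / 2 ^ k - gridShift b k) + (e : ℝ)) / ((2 : ℕ) : ℝ) := by
    rw [he, zpow_add_one₀ (by norm_num)]
    push_cast
    field_simp
    ring
  unfold gridIndex
  rw [h2, Int.floor_div_natCast, Int.floor_add_intCast]
  rfl

theorem gridIndex_eq_of_le {b : Bool} {j k : ℤ} (hjk : j ≤ k) {x y : ℝ}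
    (h : gridIndex b j x = gridIndex b j y) : gridIndex b k x = gridIndex b k y := by
  induction k, hjk using Int.leInduction with
  | base => exact h
  | succ k _ ih =>
    obtain ⟨e, he⟩ := exists_gridIndex_succ b k
    rw [he, he, ih]

theorem gridCube_subset_or_disjoint {d : ℕ} {δ : Fin d → Bool} {i j : ℤ × (Fin d → ℤ)}
    (h : i.1 ≤ j.1) : gridCube δ i ⊆ gridCube δ j ∨ Disjoint (gridCube δ i) (gridCube δ j) := by
  by_cases hd : Disjoint (gridCube δ i) (gridCube δ j)
  · exact Or.inr hd
  · obtain ⟨x, hxi, hxj⟩ := Set.not_disjoint_iff.1 hd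
    refine Or.inl fun y hy l => ?_
    rw [← hxj l]
    exact gridIndex_eq_of_le h ((hy l).trans (hxi l).symm)

theorem isLaminar_gridCube {d : ℕ} (δ : Fin d → Bool) : IsLaminar (gridCube δ) := by
  intro i j
  rcases le_total i.1 j.1 with h | h
  · rcases gridCube_subset_or_disjoint (δ := δ) h with h | h
    · exact Or.inl h
    · exact Or.inr (Or.inr h)
  · rcases gridCube_subset_or_disjoint (δ := δ) h with h | h
    · exact Or.inr (Or.inl h)
    · exact Or.inr (Or.inr h.symm)

theorem gridCube_eq_pi {d : ℕ} (δ : Fin d → Bool) (j : ℤ × (Fin d → ℤ)) :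
    gridCube δ j = Set.univ.pi fun i =>
      Set.Ico (2 ^ j.1 * (j.2 i + gridShift (δ i) j.1))
        (2 ^ j.1 * (j.2 i + gridShift (δ i) j.1) + 2 ^ j.1) := by
  have h2 : (0 : ℝ) < 2 ^ j.1 := by positivity
  ext x
  simp only [gridCube, gridIndex, Int.floor_eq_iff, Set.mem_ofPred_eq, Set.mem_univ_pi, Set.mem_Ico]
  refine forall_congr' fun i => and_congr ?_ ?_
  · rw [le_sub_iff_add_le, le_div_iff₀ h2, mul_comm]
  · rw [sub_lt_iff_lt_add, div_lt_iff₀ h2]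
    constructor <;> intro h <;> nlinarith

theorem measurableSet_gridCube {d : ℕ} (δ : Fin d → Bool) (j : ℤ × (Fin d → ℤ)) :
    MeasurableSet (gridCube δ j) := by
  rw [gridCube_eq_pi]
  exact MeasurableSet.univ_pi fun i => measurableSet_Ico

theorem exists_isCube_gridCube_ae_eq {d : ℕ} (δ : Fin d → Bool) (j : ℤ × (Fin d → ℤ)) :
    ∃ Q, IsCube Q ∧ gridCube δ j =ᵐ[volume] Q ∧ volume Q = ENNReal.ofReal (2 ^ j.1) ^ d := by
  refine ⟨_, ⟨fun i => 2 ^ j.1 * (j.2 i + gridShift (δ i) j.1), 2 ^ j.1, by positivity, rfl⟩, ?_, ?_⟩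
  · rw [gridCube_eq_pi]
    exact Measure.univ_pi_Ico_ae_eq_Icc
  · rw [Real.volume_Icc_pi]
    simp

/-- If both grids cut the interval, two endpoints `m` and `n ± 1/3` (rescaled) lie less than `1/3`
apart, impossible for integers `m`, `n`. -/
theorem exists_gridIndex_const {a l : ℝ} {k : ℤ} (h : 3 * l < 2 ^ k) :
    ∃ b, ∀ x ∈ Set.Icc a (a + l), gridIndex b k x = gridIndex b k a := by
  have h2 : (0 : ℝ) < 2 ^ k := by positivity
  by_contra! hcon
  have key : ∀ b, ∃ n : ℤ, a / 2 ^ k - gridShift b k < n ∧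
      (n : ℝ) < a / 2 ^ k - gridShift b k + 1 / 3 := by
    intro b
    obtain ⟨x, hx, hne⟩ := hcon b
    have h1 : a / 2 ^ k ≤ x / 2 ^ k := by gcongr; exact hx.1
    have h3 : x / 2 ^ k < a / 2 ^ k + 1 / 3 := by
      rw [div_add' _ _ _ h2.ne', div_lt_div_iff_of_pos_right h2]
      linarith [hx.2]
    have hlt : gridIndex b k a < gridIndex b k x :=
      lt_of_le_of_ne (Int.floor_le_floor (by linarith)) (Ne.symm hne)
    refine ⟨gridIndex b k x, ?_, ?_⟩
    · have := Int.lt_floor_add_one (a / 2 ^ k - gridShift b k)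
      have h4 : ((gridIndex b k a : ℤ) : ℝ) + 1 ≤ gridIndex b k x := by exact_mod_cast hlt
      exact this.trans_le h4
    · have := Int.floor_le (x / 2 ^ k - gridShift b k)
      unfold gridIndex
      linarith
  obtain ⟨m, hm1, hm2⟩ := key false
  obtain ⟨n, hn1, hn2⟩ := key true
  simp only [gridShift, Bool.false_eq_true, if_false, if_true] at hm1 hm2 hn1 hn2
  split_ifs at hn1 hn2
  · have h5 : n < m := by exact_mod_cast (by linarith : (n : ℝ) < m)
    have h6 : m < n + 1 := by exact_mod_cast (by linarith : (m : ℝ) < n + 1)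
    omega
  · have h5 : m < n := by exact_mod_cast (by linarith : (m : ℝ) < n)
    have h6 : n < m + 1 := by exact_mod_cast (by linarith : (n : ℝ) < m + 1)
    omega

/-- The one-third trick. -/
theorem IsCube.exists_subset_gridCube {d : ℕ} {Q : Set (Fin d → ℝ)} (hQ : IsCube Q) :
    ∃ δ j, Q ⊆ gridCube δ j ∧ ENNReal.ofReal (2 ^ j.1) ^ d ≤ 6 ^ d * volume Q := by
  obtain ⟨a, l, hl, rfl⟩ := hQ
  -- With `2^n ≤ 3l < 2^(n+1)`, generation `n + 1` has side at most `6l`: the source of the constant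
  -- 6.
  obtain ⟨n, hn⟩ := exists_mem_Ico_zpow (x := 3 * l) (y := (2 : ℝ)) (by positivity) (by norm_num)
  have hlt : 3 * l < 2 ^ (n + 1) := hn.2
  have h6 : (2 : ℝ) ^ (n + 1) ≤ 6 * l := by
    rw [zpow_add_one₀ (by norm_num)]
    linarith [hn.1]
  choose δ hδ using fun i => exists_gridIndex_const (a := a i) hlt
  refine ⟨δ, (n + 1, fun i => gridIndex (δ i) (n + 1) (a i)), fun x hx i => ?_, ?_⟩
  · exact hδ i (x i) ⟨hx.1 i, hx.2 i⟩
  · rw [Real.volume_Icc_pi]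
    simp only [add_sub_cancel_left, Finset.prod_const, Finset.card_univ, Fintype.card_fin]
    rw [← mul_pow]
    gcongr
    refine (ENNReal.ofReal_le_ofReal h6).trans ?_
    rw [ENNReal.ofReal_mul (by norm_num)]
    simp

/-! ### The estimate on a single cube. -/

section PowerWeight

variable {X : Type*} [MeasurableSpace X] {ν : Measure X} {f W : X → ℝ≥0∞}

/-- Hölder for `f = (f W^c) · W^(-c)`. -/
theorem lintegral_le_rpow_mul_rpow_weight (hf : AEMeasurable f ν) (hW : AEMeasurable W ν)
    (hW0 : ∀ᵐ x ∂ν, W x ≠ 0) (hWt : ∀ᵐ x ∂ν, W x ≠ ∞) {t : ℝ} (ht : 1 < t) (c : ℝ) :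
    ∫⁻ x, f x ∂ν ≤ (∫⁻ x, f x ^ t * W x ^ (c * t) ∂ν) ^ (1 / t) *
      (∫⁻ x, W x ^ (-(c / (1 - 1 / t))) ∂ν) ^ (1 - 1 / t) := by
  have ht0 : t ≠ 0 := by linarith
  have ht1 : t - 1 ≠ 0 := by linarith
  have h := ENNReal.lintegral_mul_le_Lp_mul_Lq ν (Real.HolderConjugate.conjExponent ht)
    (hf.mul (hW.pow_const c)) (hW.pow_const (-c))
  have e1 : ∫⁻ x, f x ∂ν = ∫⁻ x, ((f * fun x => W x ^ c) * fun x => W x ^ (-c)) x ∂ν := by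
    refine lintegral_congr_ae ?_
    filter_upwards [hW0, hWt] with x h0 h1
    simp only [Pi.mul_apply]
    rw [mul_assoc, ← ENNReal.rpow_add _ _ h0 h1]
    simp
  have e2 : ∀ x, (f * fun x => W x ^ c) x ^ t = f x ^ t * W x ^ (c * t) := fun x => by
    simp only [Pi.mul_apply]
    rw [ENNReal.mul_rpow_of_nonneg _ _ (by linarith), ENNReal.rpow_mul]
  have e3 : ∀ x, (W x ^ (-c)) ^ t.conjExponent = W x ^ (-(c / (1 - 1 / t))) := fun x => by
    rw [← ENNReal.rpow_mul]
    congr 1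
    rw [Real.conjExponent]
    field_simp
  have e4 : 1 / t.conjExponent = 1 - 1 / t := by
    rw [Real.conjExponent]
    field_simp
  simp only [e2, e3, e4] at h
  rw [e1]
  exact h

/-- The exponential as a map into `[0, ∞]`. -/
noncomputable def eexp (x : ℝ) : ℝ≥0∞ := ENNReal.ofReal (Real.exp x)

theorem eexp_rpow (x y : ℝ) : eexp x ^ y = eexp (x * y) := by
  rw [eexp, ENNReal.ofReal_rpow_of_pos (Real.exp_pos _), ← Real.exp_mul, eexp]

theorem eexp_add (x y : ℝ) : eexp (x + y) = eexp x * eexp y := by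
  rw [eexp, Real.exp_add, ENNReal.ofReal_mul (Real.exp_pos _).le, eexp, eexp]

theorem eexp_zero : eexp 0 = 1 := by simp [eexp]

theorem eexp_neg (x : ℝ) : eexp (-x) = (eexp x)⁻¹ := by
  rw [eexp, Real.exp_neg, ENNReal.ofReal_inv_of_pos (Real.exp_pos _), eexp]

theorem exists_eq_eexp {x : ℝ≥0∞} (h0 : x ≠ 0) (ht : x ≠ ∞) : ∃ y, x = eexp y := by
  refine ⟨Real.log x.toReal, ?_⟩
  rw [eexp, Real.exp_log (ENNReal.toReal_pos h0 ht), ENNReal.ofReal_toReal ht]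

theorem le_eexp_add_of_eexp_mul_le {x : ℝ≥0∞} {u v : ℝ} (h : eexp u * x ≤ eexp v) :
    x ≤ eexp (v - u) := by
  calc x = eexp (-u) * (eexp u * x) := by
        rw [← mul_assoc, ← eexp_add, neg_add_cancel, eexp_zero, one_mul]
    _ ≤ eexp (-u) * eexp v := by gcongr
    _ = eexp (v - u) := by rw [← eexp_add]; congr 1; ring

/-- An average of order `a` over a set of measure `ν univ` is controlled by the `A_r` characteristic,
the average of `f ^ t * W ^ (1 - t * a)` with respect to `W`, and the weighted norm of `f`. -/
theorem rpow_mul_lintegral_le (hf : AEMeasurable f ν) (hW : AEMeasurable W ν)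
    (hW0 : ∀ᵐ x ∂ν, W x ≠ 0) (hWt : ∀ᵐ x ∂ν, W x ≠ ∞) {p q a r t : ℝ} (hp : 1 < p) (hq : 0 < q)
    (ha : 0 ≤ a) (ha1 : a < 1) (hpq : 1 / q = 1 / p - a) (hr : 1 < r) (hr' : r < q * (1 - 1 / p) + 1)
    (ht : t = r / (1 + (r - 1) * a)) {A N : ℝ≥0∞} (hA0 : A ≠ 0) (hAt : A ≠ ∞)
    (hV0 : ν Set.univ ≠ 0) (hVt : ν Set.univ ≠ ∞)
    (hS0 : ∫⁻ x, W x ∂ν ≠ 0) (hSt : ∫⁻ x, W x ∂ν ≠ ∞)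
    (hA : ((ν Set.univ)⁻¹ * ∫⁻ x, W x ∂ν) *
      ((ν Set.univ)⁻¹ * ∫⁻ x, W x ^ (-1 / (r - 1)) ∂ν) ^ (r - 1) ≤ A)
    (hN : (∫⁻ x, f x ^ p * W x ^ (p / q) ∂ν) ^ (1 / p) ≤ N) :
    (ν Set.univ) ^ (a - 1) * ∫⁻ x, f x ∂ν ≤
      A ^ (p / (q * t)) * ((∫⁻ x, W x ∂ν)⁻¹ * ∫⁻ x, f x ^ t * W x ^ (1 - t * a) ∂ν) ^ (p / (q * t)) *
        N ^ (1 - p / q) := by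
  have hr1 : 0 < r - 1 := by linarith
  have hp0 : 0 < p := by linarith
  have hp1 : p - 1 ≠ 0 := by linarith
  have hden : 0 < 1 + (r - 1) * a := by positivity
  have ht0 : 0 < t := by rw [ht]; positivity
  have ht1 : 1 < t := by
    rw [ht, lt_div_iff₀ hden]
    nlinarith
  have hpq1 : 0 ≤ 1 - p / q := by
    have : p / q = 1 - a * p := by
      rw [div_eq_mul_one_div, hpq]; field_simp
    rw [this]
    nlinarith
  have hpp : 0 < 1 - 1 / p := by
    rw [sub_pos, div_lt_one hp0]; exact hp
  -- In logarithmic coordinates the bookkeeping of powers becomes one identity between real numbers,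
  -- `key` below.
  obtain ⟨v, hv⟩ := exists_eq_eexp hV0 hVt
  obtain ⟨s, hs⟩ := exists_eq_eexp hS0 hSt
  obtain ⟨k, hk⟩ := exists_eq_eexp hA0 hAt
  rw [hv, hs, hk] at hA
  rw [hv, hs, hk]
  set σ := ∫⁻ x, W x ^ (-1 / (r - 1)) ∂ν with hσ
  have hσle : σ ≤ eexp (v + (k + v - s) / (r - 1)) := by
    rw [← eexp_neg, ← eexp_add] at hA
    have h1 := ENNReal.rpow_le_rpow (le_eexp_add_of_eexp_mul_le hA) (one_div_nonneg.2 hr1.le)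
    rw [← ENNReal.rpow_mul, mul_one_div_cancel hr1.ne', ENNReal.rpow_one, eexp_rpow] at h1
    refine (le_eexp_add_of_eexp_mul_le h1).trans_eq ?_
    congr 1
    ring
  set J := ∫⁻ x, f x ∂ν with hJ
  set I := ∫⁻ x, f x ^ t * W x ^ (1 - t * a) ∂ν with hI
  have h1 : J ≤ I ^ (1 / t) * eexp ((v + (k + v - s) / (r - 1)) * (1 - 1 / t)) := by
    have h := lintegral_le_rpow_mul_rpow_weight hf hW hW0 hWt ht1 (1 / t - a)
    have e1 : (1 / t - a) * t = 1 - t * a := by field_simp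
    -- The value of `t` is chosen for this: the dual weight gets exactly the `A_r` exponent.
    have e2 : -((1 / t - a) / (1 - 1 / t)) = -1 / (r - 1) := by
      have h1a : 1 - a ≠ 0 := by linarith
      have h3 : 1 / t - a = (1 - a) / r := by rw [ht]; field_simp; ring
      have h4 : 1 - 1 / t = (r - 1) * (1 - a) / r := by rw [ht]; field_simp; ring
      rw [h3, h4]
      field_simp
    rw [e1, e2] at h
    refine h.trans ?_
    rw [← eexp_rpow]
    gcongr
    rw [sub_nonneg, div_le_one ht0]; exact ht1.le
  -- Here `m = p'/q`, and `r < q/p' + 1` says `(r - 1) m < 1`; `h2` is then Jensen's inequality,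
  -- obtained from Hölder with `c = 0`.
  set m := 1 / q / (1 - 1 / p) with hm
  have hm0 : 0 < m := by positivity
  have hθ0 : 0 < (r - 1) * m := by positivity
  have hθ1 : (r - 1) * m < 1 := by
    rw [hm, div_div, mul_one_div, div_lt_one (by positivity)]
    linarith
  have h2 : ∫⁻ x, W x ^ (-m) ∂ν ≤
      eexp ((v + (k + v - s) / (r - 1)) * ((r - 1) * m) + v * (1 - (r - 1) * m)) := by
    have h := lintegral_le_rpow_mul_rpow_weight (f := fun x => W x ^ (-m)) (hW.pow_const _) hW hW0
      hWt ((one_lt_div hθ0).2 hθ1) 0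
    have e1 : -m * (1 / ((r - 1) * m)) = -1 / (r - 1) := by field_simp
    simp only [← ENNReal.rpow_mul, e1, zero_mul, zero_div, neg_zero, ENNReal.rpow_zero, mul_one,
      one_div_one_div, lintegral_const, one_mul, hv, eexp_rpow v] at h
    rw [eexp_add, ← eexp_rpow]
    refine h.trans ?_
    rw [← hσ]
    gcongr
  have h3 : J ≤ N * eexp (((v + (k + v - s) / (r - 1)) * ((r - 1) * m) + v * (1 - (r - 1) * m)) *
      (1 - 1 / p)) := by
    have h := lintegral_le_rpow_mul_rpow_weight hf hW hW0 hWt hp (1 / q)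
    rw [one_div_mul_eq_div, ← hm] at h
    refine h.trans ?_
    rw [← eexp_rpow]
    gcongr
  have hJ2 : J = J ^ (p / q) * J ^ (1 - p / q) := by
    rw [← ENNReal.rpow_add_of_nonneg _ _ (by positivity) hpq1]
    simp
  rw [hJ2]
  refine (mul_le_mul_right (mul_le_mul' (ENNReal.rpow_le_rpow h1 (by positivity))
    (ENNReal.rpow_le_rpow h3 hpq1)) _).trans_eq ?_
  have he : 0 ≤ p / (q * t) := by positivity
  rw [ENNReal.mul_rpow_of_nonneg _ _ (by positivity), ENNReal.mul_rpow_of_nonneg _ _ hpq1,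
    ENNReal.mul_rpow_of_nonneg _ _ he, ← ENNReal.rpow_mul, ← eexp_neg]
  simp only [eexp_rpow]
  have e1 : 1 / t * (p / q) = p / (q * t) := by field_simp
  rw [e1]
  have key : v * (a - 1) + (v + (k + v - s) / (r - 1)) * (1 - 1 / t) * (p / q) +
      ((v + (k + v - s) / (r - 1)) * ((r - 1) * m) + v * (1 - (r - 1) * m)) * (1 - 1 / p) *
        (1 - p / q) = k * (p / (q * t)) + -s * (p / (q * t)) := by
    have ha' : a = 1 / p - 1 / q := by linarith
    have hti : 1 / t = (1 + (r - 1) * a) / r := by rw [ht, one_div_div]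
    have hpt : p / (q * t) = p / q * (1 / t) := by field_simp
    rw [hpt, hti, hm, ha']
    field_simp
    ring
  calc _ = eexp (v * (a - 1) + (v + (k + v - s) / (r - 1)) * (1 - 1 / t) * (p / q) +
      ((v + (k + v - s) / (r - 1)) * ((r - 1) * m) + v * (1 - (r - 1) * m)) * (1 - 1 / p) *
        (1 - p / q)) * I ^ (p / (q * t)) * N ^ (1 - p / q) := by
        rw [eexp_add, eexp_add]; ring
    _ = _ := by rw [key, eexp_add]; ring

end PowerWeight

theorem IsCube.volume_ne_zero_and_ne_top_and_isCompact {d : ℕ} {Q : Set (Fin d → ℝ)} (hQ : IsCube Q) :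
    volume Q ≠ 0 ∧ volume Q ≠ ∞ ∧ IsCompact Q := by
  obtain ⟨a, l, hl, rfl⟩ := hQ
  refine ⟨?_, ?_, isCompact_Icc⟩ <;> rw [Real.volume_Icc_pi]
  · simp [hl]
  · simp

/-! ### Basic facts on weights and cubes. -/

section Weight

variable {d : ℕ} {w : (Fin d → ℝ) → ℝ}

theorem IsWeight.aemeasurable_ofReal (hw : IsWeight w) :
    AEMeasurable (fun x => ENNReal.ofReal (w x)) volume :=
  hw.locallyIntegrable.aestronglyMeasurable.aemeasurable.ennreal_ofReal

theorem IsWeight.setLIntegral_ne_top (hw : IsWeight w) {Q : Set (Fin d → ℝ)} (hQ : IsCompact Q) :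
    ∫⁻ x in Q, ENNReal.ofReal (w x) ≠ ∞ := by
  have h := (hw.locallyIntegrable.integrableOn_isCompact hQ).hasFiniteIntegral
  refine ne_top_of_le_ne_top h.ne (lintegral_mono fun x => ?_)
  rw [← ofReal_norm]
  exact ENNReal.ofReal_le_ofReal (Real.le_norm_self _)

theorem IsWeight.setLIntegral_ne_zero (hw : IsWeight w) {Q : Set (Fin d → ℝ)}
    (hQ : volume Q ≠ 0) : ∫⁻ x in Q, ENNReal.ofReal (w x) ≠ 0 := by
  intro h
  rw [lintegral_eq_zero_iff' hw.aemeasurable_ofReal.restrict] at h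
  have hF : ∀ᵐ x ∂(volume.restrict Q), False := by
    filter_upwards [h, ae_restrict_of_ae hw.pos] with x h1 h2
    exact (ENNReal.ofReal_pos.2 h2).ne' h1
  rw [ae_iff] at hF
  simp [hQ] at hF

theorem IsWeight.ofReal_rpow_ae_eq (hw : IsWeight w) (c : ℝ) :
    (fun x => ENNReal.ofReal (w x ^ c)) =ᵐ[volume] fun x => ENNReal.ofReal (w x) ^ c := by
  filter_upwards [hw.pos] with x hx
  rw [ENNReal.ofReal_rpow_of_pos hx]

theorem IsWeight.average_mul_average_rpow_le (hw : IsWeight w) (r : ℝ) {Q : Set (Fin d → ℝ)}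
    (hQ : IsCube Q) :
    ((volume Q)⁻¹ * ∫⁻ x in Q, ENNReal.ofReal (w x)) *
      ((volume Q)⁻¹ * ∫⁻ x in Q, ENNReal.ofReal (w x) ^ (-1 / (r - 1))) ^ (r - 1) ≤ apChar r w := by
  rw [← lintegral_congr_ae (ae_restrict_of_ae (hw.ofReal_rpow_ae_eq (-1 / (r - 1))))]
  exact le_iSup₂ (f := fun (Q : Set (Fin d → ℝ)) (_ : IsCube Q) =>
    ((volume Q)⁻¹ * ∫⁻ x in Q, ENNReal.ofReal (w x)) *
      ((volume Q)⁻¹ * ∫⁻ x in Q, ENNReal.ofReal (w x ^ (-1 / (r - 1)))) ^ (r - 1)) Q hQ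

/-- Hölder for the constant 1 on the unit cube. -/
theorem IsWeight.one_le_apChar (hw : IsWeight w) {r : ℝ} (hr : 1 < r) : 1 ≤ apChar r w := by
  have hQ : IsCube (Set.Icc (0 : Fin d → ℝ) fun i => (0 : Fin d → ℝ) i + 1) :=
    ⟨0, 1, one_pos, rfl⟩
  refine le_trans ?_ (hw.average_mul_average_rpow_le r hQ)
  set Q := Set.Icc (0 : Fin d → ℝ) fun i => (0 : Fin d → ℝ) i + 1
  have hV : volume Q = 1 := by rw [Real.volume_Icc_pi]; simp
  have h := lintegral_le_rpow_mul_rpow_weight (ν := volume.restrict Q) (f := fun _ => 1)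
    aemeasurable_const hw.aemeasurable_ofReal.restrict
    (ae_restrict_of_ae (hw.pos.mono fun x hx => (ENNReal.ofReal_pos.2 hx).ne'))
    (Filter.Eventually.of_forall fun x => ENNReal.ofReal_ne_top) hr (1 / r)
  have hr0 : 0 < r := by linarith
  have e1 : -(1 / r / (1 - 1 / r)) = -1 / (r - 1) := by
    have : r - 1 ≠ 0 := by linarith
    field_simp
  have e2 : 1 / r * r = 1 := by field_simp
  have e3 : (1 - 1 / r) * r = r - 1 := by field_simp
  simp only [lintegral_one, Measure.restrict_apply_univ, hV, ENNReal.one_rpow, one_mul, e1, e2,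
    ENNReal.rpow_one] at h
  have h2 := ENNReal.rpow_le_rpow h hr0.le
  rw [ENNReal.mul_rpow_of_nonneg _ _ hr0.le, ← ENNReal.rpow_mul, ← ENNReal.rpow_mul, e2, e3] at h2
  simpa [hV] using h2

end Weight

/-- Since `a - 1 < 0`, the larger cube costs `(6^d)^(1-a) ≤ 6^d`. -/
theorem rpow_sub_one_mul_lintegral_le {d : ℕ} {a : ℝ} (ha : 0 ≤ a) (ha1 : a < 1)
    {f : (Fin d → ℝ) → ℝ≥0∞} {Q R : Set (Fin d → ℝ)} (hQR : ∫⁻ u in Q, f u ≤ ∫⁻ u in R, f u)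
    (hQt : volume Q ≠ ∞) (hV : volume R ≤ 6 ^ d * volume Q) :
    volume Q ^ (a - 1) * ∫⁻ u in Q, f u ≤ 6 ^ d * (volume R ^ (a - 1) * ∫⁻ u in R, f u) := by
  have h6 : (1 : ℝ≥0∞) ≤ 6 ^ d := one_le_pow₀ (by norm_num)
  have h60 : (6 : ℝ≥0∞) ^ d ≠ 0 := by positivity
  have h6t : (6 : ℝ≥0∞) ^ d ≠ ∞ := ENNReal.pow_ne_top (by simp)
  rw [← mul_assoc]
  refine mul_le_mul' ?_ hQR
  have h1 : ((6 : ℝ≥0∞) ^ d * volume Q) ^ (a - 1) ≤ volume R ^ (a - 1) := by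
    rw [← neg_sub 1 a, ENNReal.rpow_neg, ENNReal.rpow_neg, ENNReal.inv_le_inv]
    exact ENNReal.rpow_le_rpow hV (by linarith)
  calc volume Q ^ (a - 1)
      = (6 ^ d) ^ (1 - a) * ((6 ^ d) ^ (a - 1) * volume Q ^ (a - 1)) := by
        rw [← mul_assoc, ← ENNReal.rpow_add _ _ h60 h6t]
        simp
    _ = (6 ^ d) ^ (1 - a) * (6 ^ d * volume Q) ^ (a - 1) := by
        rw [ENNReal.mul_rpow_of_ne_top h6t hQt]
    _ ≤ 6 ^ d * volume R ^ (a - 1) := by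
        refine mul_le_mul' ?_ h1
        calc ((6 : ℝ≥0∞) ^ d) ^ (1 - a) ≤ (6 ^ d) ^ (1 : ℝ) :=
              ENNReal.rpow_le_rpow_of_exponent_le h6 (by linarith)
          _ = 6 ^ d := ENNReal.rpow_one _

theorem fracMaximal_eq_zero {d : ℕ} {α : ℝ} {φ : (Fin d → ℝ) → ℝ} (h : ∀ᵐ x, φ x = 0)
    (x : Fin d → ℝ) : fracMaximal α φ x = 0 := by
  have h0 : ∀ Q : Set (Fin d → ℝ), ∫⁻ u in Q, ENNReal.ofReal |φ u| = 0 := fun Q => by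
    rw [lintegral_congr_ae (g := fun _ => 0)]
    · simp
    · filter_upwards [ae_restrict_of_ae h] with u hu
      simp [hu]
  simp [fracMaximal, h0]

/-! ### The exponent `s` in terms of `t`. -/

section Exponents

variable {p q a r t : ℝ}

theorem sExponent_eq (hp : 1 < p) (hq : 0 < q) (ha : 0 ≤ a) (hpq : 1 / q = 1 / p - a)
    (hr : 1 < r) (ht : t = r / (1 + (r - 1) * a)) : sExponent p q r = q * (1 - t / p) := by
  have hp0 : 0 < p := by linarith
  have hr1 : 0 < r - 1 := by linarith
  have hden : 0 < 1 + (r - 1) * a := by positivity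
  have hD : (r - 1) * (q - p) + p * q = p * q * (1 + (r - 1) * a) := by
    have ha' : a = 1 / p - 1 / q := by linarith
    rw [ha']
    field_simp
    ring
  rw [sExponent, hD, ht]
  field_simp

theorem one_div_sub_sExponent (hp : 1 < p) (hq : 0 < q) (ha : 0 ≤ a) (hpq : 1 / q = 1 / p - a)
    (hr : 1 < r) (ht : t = r / (1 + (r - 1) * a)) :
    1 / (q - sExponent p q r) = p / (q * t) := by
  have hp0 : p ≠ 0 := by linarith
  have h : q - sExponent p q r = q * t / p := by
    rw [sExponent_eq hp hq ha hpq hr ht]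
    field_simp
    ring
  rw [h, one_div_div]

theorem div_sExponent (hp : 1 < p) (hq : 0 < q) (ha : 0 ≤ a) (hpq : 1 / q = 1 / p - a)
    (hr : 1 < r) (ht : t = r / (1 + (r - 1) * a)) (ht0 : 0 < t) :
    q / sExponent p q r = p / t / (p / t - 1) := by
  have hp0 : p ≠ 0 := by linarith
  have h : p / t - 1 = p / t * (1 - t / p) := by field_simp
  have hpt : p / t ≠ 0 := div_ne_zero hp0 ht0.ne'
  rw [sExponent_eq hp hq ha hpq hr ht, h, div_mul_cancel_left₀ hq.ne', div_mul_cancel_left₀ hpt]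

theorem one_lt_div_of_lt (hp : 1 < p) (hq : 0 < q) (ha : 0 ≤ a) (hpq : 1 / q = 1 / p - a)
    (hr : 1 < r) (hr' : r < q * (1 - 1 / p) + 1) (ht : t = r / (1 + (r - 1) * a)) : 1 < p / t := by
  have hp0 : 0 < p := by linarith
  have hr1 : 0 < r - 1 := by linarith
  have hden : 0 < 1 + (r - 1) * a := by positivity
  have h1 : (r - 1) / q < 1 - 1 / p := by
    rw [div_lt_iff₀ hq]; linarith
  have h2 : p * ((r - 1) / q) < p - 1 := by
    calc p * ((r - 1) / q) < p * (1 - 1 / p) := by gcongr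
      _ = p - 1 := by field_simp
  have h3 : p * (1 + (r - 1) * a) = p + (r - 1) - p * ((r - 1) / q) := by
    have ha' : a = 1 / p - 1 / q := by linarith
    rw [ha']
    field_simp
    ring
  rw [ht, one_lt_div (by positivity), div_lt_iff₀ hden, h3]
  linarith

end Exponents

/-! ### From one cube to the norm inequality. -/

section Bound

variable {d : ℕ} {α a p q r t : ℝ} {w φ : (Fin d → ℝ) → ℝ}

theorem IsWeight.weightedNorm_rpow_eq (hw : IsWeight w) (p c : ℝ) :
    weightedNorm p (fun x => w x ^ c) φ =
      (∫⁻ x, ENNReal.ofReal |φ x| ^ p * ENNReal.ofReal (w x) ^ c) ^ (1 / p) := by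
  unfold weightedNorm
  congr 1
  refine lintegral_congr_ae ?_
  filter_upwards [hw.ofReal_rpow_ae_eq c] with x hx
  rw [hx, Real.enorm_eq_ofReal_abs]

theorem AEMeasurable.ofReal_abs {X : Type*} [MeasurableSpace X] {μ : Measure X} {φ : X → ℝ}
    (hφ : AEMeasurable φ μ) : AEMeasurable (fun x => ENNReal.ofReal |φ x|) μ :=
  (continuous_abs.measurable.comp_aemeasurable hφ).ennreal_ofReal

theorem IsWeight.ofReal_ne_zero (hw : IsWeight w) : ∀ᵐ x, ENNReal.ofReal (w x) ≠ 0 :=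
  hw.pos.mono fun _ hx => (ENNReal.ofReal_pos.2 hx).ne'

theorem IsWeight.aemeasurable_rpow_mul_rpow (hw : IsWeight w) (hφ : AEMeasurable φ) (t c : ℝ) :
    AEMeasurable (fun x => ENNReal.ofReal |φ x| ^ t * ENNReal.ofReal (w x) ^ c) volume :=
  (hφ.ofReal_abs.pow_const _).mul (hw.aemeasurable_ofReal.pow_const _)

theorem IsWeight.mul_rpow_ae_eq (hw : IsWeight w) (F : (Fin d → ℝ) → ℝ≥0∞) (c : ℝ) :
    (fun x => ENNReal.ofReal (w x) * (F x * ENNReal.ofReal (w x) ^ c)) =ᵐ[volume]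
      fun x => F x * ENNReal.ofReal (w x) ^ (1 + c) := by
  filter_upwards [hw.ofReal_ne_zero] with x hx
  rw [ENNReal.rpow_add _ _ hx ENNReal.ofReal_ne_top, ENNReal.rpow_one]
  ring

theorem IsCube.rpow_mul_setLIntegral_le (ha : 0 ≤ a) (ha1 : a < 1) (hp : 1 < p) (hq : 0 < q)
    (hpq : 1 / q = 1 / p - a) (hr : 1 < r) (hr' : r < q * (1 - 1 / p) + 1)
    (ht : t = r / (1 + (r - 1) * a)) (hw : IsWeight w) (hφ : AEMeasurable φ)
    (hAt : apChar r w ≠ ∞) {Q : Set (Fin d → ℝ)} (hQ : IsCube Q) :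
    volume Q ^ (a - 1) * ∫⁻ x in Q, ENNReal.ofReal |φ x| ≤
      apChar r w ^ (p / (q * t)) *
        ((∫⁻ x in Q, ENNReal.ofReal (w x))⁻¹ *
          ∫⁻ x in Q, ENNReal.ofReal |φ x| ^ t * ENNReal.ofReal (w x) ^ (1 - t * a)) ^ (p / (q * t)) *
        weightedNorm p (fun x => w x ^ (p / q)) φ ^ (1 - p / q) := by
  obtain ⟨hV0, hVt, hc⟩ := hQ.volume_ne_zero_and_ne_top_and_isCompact
  have h := rpow_mul_lintegral_le (ν := volume.restrict Q) (A := apChar r w)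
    (N := weightedNorm p (fun x => w x ^ (p / q)) φ) hφ.ofReal_abs.restrict
    hw.aemeasurable_ofReal.restrict (ae_restrict_of_ae hw.ofReal_ne_zero)
    (Filter.Eventually.of_forall fun x => ENNReal.ofReal_ne_top) hp hq ha ha1 hpq hr hr' ht
    (zero_lt_one.trans_le (hw.one_le_apChar hr)).ne' hAt
    (by rwa [Measure.restrict_apply_univ]) (by rwa [Measure.restrict_apply_univ])
    (hw.setLIntegral_ne_zero hV0) (hw.setLIntegral_ne_top hc)
    (by rw [Measure.restrict_apply_univ]; exact hw.average_mul_average_rpow_le r hQ)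
    (by
      rw [hw.weightedNorm_rpow_eq]
      exact ENNReal.rpow_le_rpow (setLIntegral_le_lintegral _ _)
        (one_div_nonneg.2 (by linarith)))
  rwa [Measure.restrict_apply_univ] at h

/-- The density `w` supplies the missing 1 in the exponent `1 - ta`; half-open and closed cubes
differ by a null set. -/
theorem average_le_familyMaximal_gridCube (hw : IsWeight w) (hφ : AEMeasurable φ) (t a : ℝ)
    {δ : Fin d → Bool} {j : ℤ × (Fin d → ℤ)} {Q : Set (Fin d → ℝ)}
    (hQ : gridCube δ j =ᵐ[volume] Q) {x : Fin d → ℝ} (hx : x ∈ gridCube δ j) :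
    (∫⁻ x in Q, ENNReal.ofReal (w x))⁻¹ *
        ∫⁻ x in Q, ENNReal.ofReal |φ x| ^ t * ENNReal.ofReal (w x) ^ (1 - t * a) ≤
      familyMaximal (volume.withDensity fun x => ENNReal.ofReal (w x)) (gridCube δ)
        (fun x => ENNReal.ofReal |φ x| ^ t * ENNReal.ofReal (w x) ^ (-(t * a))) x := by
  refine le_trans (le_of_eq ?_) (le_iSup _ j)
  have hm := measurableSet_gridCube δ j
  rw [Set.indicator_of_mem hx, withDensity_apply _ hm,
    setLIntegral_withDensity_eq_lintegral_mul₀ hw.aemeasurable_ofReal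
      (hw.aemeasurable_rpow_mul_rpow hφ t _) hm,
    setLIntegral_congr hQ, setLIntegral_congr hQ]
  congr 1
  have h := hw.mul_rpow_ae_eq (fun x => ENNReal.ofReal |φ x| ^ t) (-(t * a))
  rw [← sub_eq_add_neg] at h
  exact lintegral_congr_ae (ae_restrict_of_ae h.symm)

theorem fracMaximal_le_iSup_familyMaximal (ha : 0 ≤ a) (ha1 : a < 1) (haα : α / d = a) (hp : 1 < p)
    (hq : 0 < q) (hpq : 1 / q = 1 / p - a) (hr : 1 < r) (hr' : r < q * (1 - 1 / p) + 1)
    (ht : t = r / (1 + (r - 1) * a)) (ht0 : 0 < t) (hw : IsWeight w) (hφ : AEMeasurable φ)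
    (hAt : apChar r w ≠ ∞) (x : Fin d → ℝ) :
    fracMaximal α φ x ≤ ⨆ δ, 6 ^ d * (apChar r w ^ (p / (q * t)) *
      familyMaximal (volume.withDensity fun x => ENNReal.ofReal (w x)) (gridCube δ)
        (fun x => ENNReal.ofReal |φ x| ^ t * ENNReal.ofReal (w x) ^ (-(t * a))) x ^ (p / (q * t)) *
      weightedNorm p (fun x => w x ^ (p / q)) φ ^ (1 - p / q)) := by
  refine iSup₂_le fun Q hQ => iSup_le fun hxQ => ?_
  obtain ⟨δ, j, hQj, hvol⟩ := hQ.exists_subset_gridCube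
  obtain ⟨R, hR, hjR, hRvol⟩ := exists_isCube_gridCube_ae_eq δ j
  refine le_trans ?_ (le_iSup _ δ)
  rw [haα]
  have hQR : ∫⁻ u in Q, ENNReal.ofReal |φ u| ≤ ∫⁻ u in R, ENNReal.ofReal |φ u| := by
    rw [← setLIntegral_congr hjR]
    exact lintegral_mono_set hQj
  refine (rpow_sub_one_mul_lintegral_le ha ha1 hQR hQ.volume_ne_zero_and_ne_top_and_isCompact.2.1
    (hRvol.trans_le hvol)).trans ?_
  gcongr 6 ^ d * ?_
  refine (hR.rpow_mul_setLIntegral_le ha ha1 hp hq hpq hr hr' ht hw hφ hAt).trans ?_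
  have : 0 ≤ p / (q * t) := div_nonneg (by linarith) (by positivity)
  gcongr
  exact average_le_familyMaximal_gridCube hw hφ t a hjR (hQj hxQ)

theorem lintegral_familyMaximal_gridCube_le (hp : 0 < p) (hpq : p / q = 1 - a * p)
    (ht0 : 0 < t) (htp : 1 < p / t) (hw : IsWeight w) (hφ : AEMeasurable φ) (δ : Fin d → Bool) :
    ∫⁻ x, familyMaximal (volume.withDensity fun x => ENNReal.ofReal (w x)) (gridCube δ)
        (fun x => ENNReal.ofReal |φ x| ^ t * ENNReal.ofReal (w x) ^ (-(t * a))) x ^ (p / t) *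
          ENNReal.ofReal (w x) ≤
      ENNReal.ofReal (p / t / (p / t - 1)) ^ (p / t) *
        weightedNorm p (fun x => w x ^ (p / q)) φ ^ p := by
  set g : (Fin d → ℝ) → ℝ≥0∞ :=
    fun x => ENNReal.ofReal |φ x| ^ t * ENNReal.ofReal (w x) ^ (-(t * a)) with hg
  set μ := volume.withDensity fun x => ENNReal.ofReal (w x) with hμ
  have hgm : AEMeasurable g volume := hw.aemeasurable_rpow_mul_rpow hφ t _
  have hfin : ∀ j, μ (gridCube δ j) ≠ ∞ := fun j => by
    obtain ⟨R, hR, hjR, -⟩ := exists_isCube_gridCube_ae_eq δ j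
    rw [hμ, withDensity_apply _ (measurableSet_gridCube δ j), setLIntegral_congr hjR]
    exact hw.setLIntegral_ne_top hR.volume_ne_zero_and_ne_top_and_isCompact.2.2
  have h := (isLaminar_gridCube δ).lintegral_familyMaximal_rpow_le (measurableSet_gridCube δ) hfin
    (hgm.mono_ac (withDensity_absolutelyContinuous _ _)) htp
  have hM : Measurable (familyMaximal μ (gridCube δ) g) :=
    measurable_familyMaximal (measurableSet_gridCube δ)
  rw [hμ, lintegral_withDensity_eq_lintegral_mul₀ hw.aemeasurable_ofReal
    (hM.pow_const _).aemeasurable, lintegral_withDensity_eq_lintegral_mul₀ hw.aemeasurable_ofReal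
    (hgm.pow_const _)] at h
  simp only [mul_comm _ (ENNReal.ofReal (w _))]
  refine h.trans_eq ?_
  rw [hw.weightedNorm_rpow_eq, ← ENNReal.rpow_mul, one_div_mul_cancel hp.ne', ENNReal.rpow_one]
  congr 1
  refine lintegral_congr_ae ((Filter.EventuallyEq.of_eq ?_).trans
    ((hw.mul_rpow_ae_eq (fun x => ENNReal.ofReal |φ x| ^ p) (-(t * a) * (p / t))).trans
      (Filter.EventuallyEq.of_eq ?_)))
  · funext x
    simp only [Pi.mul_apply, hg]
    rw [ENNReal.mul_rpow_of_nonneg _ _ (by positivity), ← ENNReal.rpow_mul, ← ENNReal.rpow_mul,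
      mul_div_cancel₀ _ ht0.ne']
  · funext x
    rw [hpq]
    congr 2
    field_simp
    ring

theorem weightedNorm_fracMaximal_le_of_ne_top (ha : 0 ≤ a) (ha1 : a < 1) (haα : α / d = a)
    (hp : 1 < p) (hq : 0 < q) (hpq : 1 / q = 1 / p - a) (hr : 1 < r)
    (hr' : r < q * (1 - 1 / p) + 1) (hw : IsWeight w) (hφ : AEMeasurable φ)
    (hAt : apChar r w ≠ ∞) (hN0 : weightedNorm p (fun x => w x ^ (p / q)) φ ≠ 0)
    (hNt : weightedNorm p (fun x => w x ^ (p / q)) φ ≠ ∞) :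
    weightedNorm q w (fracMaximal α φ) ≤
      (12 : ℝ≥0∞) ^ d * (apChar r w ^ (1 / (q - sExponent p q r)) *
        ENNReal.ofReal (q / sExponent p q r) ^ (1 / (q - sExponent p q r))) *
      weightedNorm p (fun x => w x ^ (p / q)) φ := by
  have hp0 : 0 < p := by linarith
  have hr1 : 0 < r - 1 := by linarith
  obtain ⟨t, ht⟩ : ∃ t, t = r / (1 + (r - 1) * a) := ⟨_, rfl⟩
  have ht0 : 0 < t := by rw [ht]; positivity
  have hpq' : p / q = 1 - a * p := by rw [div_eq_mul_one_div, hpq]; field_simp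
  have hq1 : 1 ≤ q := by
    have : p / q ≤ 1 := by rw [hpq']; nlinarith
    rw [div_le_one hq] at this
    linarith
  rw [one_div_sub_sExponent hp hq ha hpq hr ht, div_sExponent hp hq ha hpq hr ht ht0]
  have htp := one_lt_div_of_lt hp hq ha hpq hr hr' ht
  set e := p / (q * t) with he
  have he0 : 0 ≤ e := by positivity
  set A := apChar r w
  set N := weightedNorm p (fun x => w x ^ (p / q)) φ
  set T := ENNReal.ofReal (p / t / (p / t - 1))
  set M : (Fin d → Bool) → (Fin d → ℝ) → ℝ≥0∞ := fun δ =>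
    familyMaximal (volume.withDensity fun x => ENNReal.ofReal (w x)) (gridCube δ)
      (fun x => ENNReal.ofReal |φ x| ^ t * ENNReal.ofReal (w x) ^ (-(t * a))) with hMdef
  have hM : ∀ δ, Measurable (M δ) := fun δ => measurable_familyMaximal (measurableSet_gridCube δ)
  set K := 6 ^ d * A ^ e * N ^ (1 - p / q) with hK
  -- The supremum over the `2^d` grids is replaced by a sum.
  have hpoint : ∀ x, fracMaximal α φ x ^ q ≤ ∑ δ, K ^ q * M δ x ^ (p / t) := fun x => by
    rw [← ENNReal.le_rpow_inv_iff hq]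
    refine (fracMaximal_le_iSup_familyMaximal ha ha1 haα hp hq hpq hr hr' ht ht0 hw hφ hAt x).trans
      (iSup_le fun δ => ?_)
    rw [ENNReal.le_rpow_inv_iff hq]
    refine le_trans (le_of_eq ?_) (Finset.single_le_sum
      (f := fun δ => K ^ q * M δ x ^ (p / t)) (fun _ _ => zero_le) (Finset.mem_univ δ))
    have e1 : p / t = e * q := by rw [he]; field_simp
    simp only [e1]
    rw [ENNReal.rpow_mul, ← ENNReal.mul_rpow_of_nonneg _ _ hq.le, hK]
    congr 1
    ring
  have hint : ∫⁻ x, fracMaximal α φ x ^ q * ENNReal.ofReal (w x) ≤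
      2 ^ d * (K ^ q * (T ^ (p / t) * N ^ p)) := by
    calc ∫⁻ x, fracMaximal α φ x ^ q * ENNReal.ofReal (w x)
        ≤ ∫⁻ x, ∑ δ, K ^ q * (M δ x ^ (p / t) * ENNReal.ofReal (w x)) := by
          refine lintegral_mono fun x => ?_
          simp only [← mul_assoc]
          rw [← Finset.sum_mul]
          gcongr
          exact hpoint x
      _ = ∑ δ, K ^ q * ∫⁻ x, M δ x ^ (p / t) * ENNReal.ofReal (w x) := by
          have hm : ∀ δ, AEMeasurable (fun x => M δ x ^ (p / t) * ENNReal.ofReal (w x)) volume :=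
            fun δ => ((hM δ).pow_const _).aemeasurable.mul hw.aemeasurable_ofReal
          rw [lintegral_finsetSum' _ fun δ _ => (hm δ).const_mul _]
          exact Finset.sum_congr rfl fun δ _ => lintegral_const_mul'' _ (hm δ)
      _ ≤ ∑ _δ : Fin d → Bool, K ^ q * (T ^ (p / t) * N ^ p) := by
          refine Finset.sum_le_sum fun δ _ => ?_
          gcongr
          exact lintegral_familyMaximal_gridCube_le hp0 hpq' ht0 htp hw hφ δ
      _ = 2 ^ d * (K ^ q * (T ^ (p / t) * N ^ p)) := by simp
  unfold weightedNorm
  rw [one_div, ENNReal.rpow_inv_le_iff hq]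
  refine hint.trans ?_
  -- As `q ≥ 1`, the number of grids can be put inside the `q`-th power.
  have h2 : (2 : ℝ≥0∞) ^ d ≤ (2 ^ d) ^ q := by
    calc (2 : ℝ≥0∞) ^ d = (2 ^ d) ^ (1 : ℝ) := (ENNReal.rpow_one _).symm
      _ ≤ (2 ^ d) ^ q := ENNReal.rpow_le_rpow_of_exponent_le (one_le_pow₀ (by norm_num)) hq1
  have e1 : T ^ (p / t) = (T ^ e) ^ q := by
    rw [← ENNReal.rpow_mul]; congr 1; rw [he]; field_simp
  have e2 : N ^ p = (N ^ (p / q)) ^ q := by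
    rw [← ENNReal.rpow_mul]; congr 1; field_simp
  have e3 : N = N ^ (1 - p / q) * N ^ (p / q) := by
    rw [← ENNReal.rpow_add _ _ hN0 hNt]; simp
  rw [e1, e2]
  refine (mul_le_mul_left h2 _).trans_eq ?_
  simp only [← ENNReal.mul_rpow_of_nonneg _ _ hq.le]
  congr 1
  conv_rhs => rw [e3]
  rw [hK, show (12 : ℝ≥0∞) = 2 * 6 by norm_num, mul_pow]
  ring

theorem ae_eq_zero_of_weightedNorm_eq_zero (hw : IsWeight w) (hφ : AEMeasurable φ) (hp : 0 < p)
    {c : ℝ} (h : weightedNorm p (fun x => w x ^ c) φ = 0) : ∀ᵐ x, φ x = 0 := by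
  rw [hw.weightedNorm_rpow_eq, ENNReal.rpow_eq_zero_iff_of_pos (by positivity),
    lintegral_eq_zero_iff' (hw.aemeasurable_rpow_mul_rpow hφ p c)] at h
  filter_upwards [h, hw.ofReal_ne_zero] with x hx hx0
  have hne : ENNReal.ofReal (w x) ^ c ≠ 0 := by simp [ENNReal.rpow_eq_zero_iff, hx0]
  have h1 := (mul_eq_zero.1 hx).resolve_right hne
  rw [ENNReal.rpow_eq_zero_iff_of_pos hp, ENNReal.ofReal_eq_zero] at h1
  exact abs_eq_zero.1 (le_antisymm h1 (abs_nonneg _))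

end Bound

theorem theorem1p1 (d : ℕ) (α p q : ℝ) (hα : 0 ≤ α) (hαd : α < (d : ℝ))
    (hp : 1 < p) (hq : 0 < q) (hpq : 1 / q = 1 / p - α / (d : ℝ))
    (w : (Fin d → ℝ) → ℝ) (hw : IsApWeight (q / (p / (p - 1)) + 1) w)
    (φ : (Fin d → ℝ) → ℝ) (hφ : LocallyIntegrable φ volume) :
    weightedNorm q w (fracMaximal α φ) ≤
      (12 : ℝ≥0∞) ^ d *
        (⨅ r ∈ Set.Ioo (1 : ℝ) (q / (p / (p - 1)) + 1),
          apChar r w ^ (1 / (q - sExponent p q r)) *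
            ENNReal.ofReal (q / sExponent p q r) ^ (1 / (q - sExponent p q r))) *
        weightedNorm p (fun x => w x ^ (p / q)) φ := by
  have hd : (0 : ℝ) < d := hα.trans_lt hαd
  obtain ⟨a, haα⟩ : ∃ a, α / (d : ℝ) = a := ⟨_, rfl⟩
  have ha : 0 ≤ a := haα ▸ div_nonneg hα hd.le
  have ha1 : a < 1 := haα ▸ (div_lt_one hd).2 hαd
  rw [haα] at hpq
  have hφm : AEMeasurable φ volume := hφ.aestronglyMeasurable.aemeasurable
  have hw := hw.1
  have hp0 : 0 < p := by linarith
  have hrr : q / (p / (p - 1)) + 1 = q * (1 - 1 / p) + 1 := by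
    have : p - 1 ≠ 0 := by linarith
    field_simp
  rw [hrr]
  have hpos : ∀ r ∈ Set.Ioo (1 : ℝ) (q * (1 - 1 / p) + 1),
      0 < 1 / (q - sExponent p q r) ∧ 1 < q / sExponent p q r := fun r hr => by
    have hr1 : 0 < r - 1 := by linarith [hr.1]
    have hr0 : 0 < r := by linarith
    obtain ⟨t, ht⟩ : ∃ t, t = r / (1 + (r - 1) * a) := ⟨_, rfl⟩
    have ht0 : 0 < t := by rw [ht]; positivity
    have htp := one_lt_div_of_lt hp hq ha hpq hr.1 hr.2 ht
    refine ⟨?_, ?_⟩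
    · rw [one_div_sub_sExponent hp hq ha hpq hr.1 ht]; positivity
    · rw [div_sExponent hp hq ha hpq hr.1 ht ht0, one_lt_div (by linarith)]
      linarith
  have h12 : (12 : ℝ≥0∞) ^ d ≠ 0 := by positivity
  have h12t : (12 : ℝ≥0∞) ^ d ≠ ∞ := ENNReal.pow_ne_top (by simp)
  have hfac : ∀ r ∈ Set.Ioo (1 : ℝ) (q * (1 - 1 / p) + 1),
      1 ≤ ENNReal.ofReal (q / sExponent p q r) ^ (1 / (q - sExponent p q r)) := fun r hr =>
    ENNReal.one_le_rpow (ENNReal.one_le_ofReal.2 (hpos r hr).2.le) (hpos r hr).1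
  set N := weightedNorm p (fun x => w x ^ (p / q)) φ with hN
  rcases eq_or_ne N 0 with hN0 | hN0
  · have h0 := fracMaximal_eq_zero (α := α) (ae_eq_zero_of_weightedNorm_eq_zero hw hφm hp0 hN0)
    have : weightedNorm q w (fracMaximal α φ) = 0 := by
      simp [weightedNorm, h0, hq]
    rw [this]
    exact zero_le
  rcases eq_or_ne N ∞ with hNt | hNt
  -- The infimum must be nonzero because `0 * ∞ = 0`.
  · have hinf : 1 ≤ ⨅ r ∈ Set.Ioo (1 : ℝ) (q * (1 - 1 / p) + 1),
        apChar r w ^ (1 / (q - sExponent p q r)) *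
          ENNReal.ofReal (q / sExponent p q r) ^ (1 / (q - sExponent p q r)) :=
      le_iInf₂ fun r hr => one_le_mul
        (ENNReal.one_le_rpow (hw.one_le_apChar hr.1) (hpos r hr).1) (hfac r hr)
    rw [hNt, ENNReal.mul_top (mul_ne_zero h12 (zero_lt_one.trans_le hinf).ne')]
    exact le_top
  simp only [ENNReal.mul_iInf_of_ne h12 h12t, ENNReal.iInf_mul_of_ne hN0 hNt]
  refine le_iInf₂ fun r hr => ?_
  -- The infimum also runs over those `r` for which `w` is not an `A_r` weight; their terms are
  -- infinite.
  rcases eq_or_ne (apChar r w) ∞ with hAt | hAt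
  · rw [hAt, ENNReal.top_rpow_of_pos (hpos r hr).1,
      ENNReal.top_mul (zero_lt_one.trans_le (hfac r hr)).ne', ENNReal.mul_top h12,
      ENNReal.top_mul hN0]
    exact le_top
  · exact weightedNorm_fracMaximal_le_of_ne_top ha ha1 haα hp hq hpq hr.1 hr.2 hw hφm hAt hN0 hNt
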